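/- **Setting.** Let $\psi_1\equiv 1$, $\psi_{2j}(t)=\sqrt2\cos(2\pi jt)$, $\psi_{2j+1}(t)=\sqrt2\sin(2\pi jt)$ ($j\ge 1$) be the trigonometric basis of the real Hilbert space $L^2[0,1]$ with norm $\|\cdot\|$. Let $\sigma>0$, $\rho>0$, $d\ge 1$, let $p$ be a real number and $s\ge 0$ an integer with $s\le p$. Put $w^p_1=1$, $w^p_{2j}=w^p_{2j+1}=j^{2p}$ for $j\ge 1$, and let $$\mathcal W_p^\rho=\Bigl\{f\in L^2[0,1]:\ \sum_{j\ge 1} w^p_j\,\langle f,\psi_j\rangle^2\le\rho\Bigr\}$$ be the corresponding ellipsoid in the Sobolev space of periodic functions. For $\beta\in\mathcal W_p^\rho$ let $\beta^{(s)}\in L^2[0,1]$ be its $s$-th weak derivative on $(0,1)$. Let $X$ be a centered random function in $L^2[0,1]$ with $\mathbb E\|X\|^2<\infty$ which is second order stationary in the sense that its covariance operator $Tf=\mathbb E[\langle f,X\rangle X]$ has the eigenfunctions $\psi_j$, with associated eigenvalues $\lambda_j$: $T\psi_j=\lambda_j\psi_j$, $j\ge 1$. Given a sequence $\upsilon=(\upsilon_j)_{j\ge1}$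 of positive weights, assume the link condition $1/d\le\lambda_j/\upsilon_j\le d$ for all $j\ge 1$. Let $\varepsilon\sim\mathcal N(0,1)$ be independent of $X$, and for a slope function $\beta$ let $$Y=\int_0^1\beta(t)X(t)\,dt+\sigma\varepsilon .$$ An estimator of $\beta^{(s)}$ is any measurable function $\widetilde\beta^{(s)}$ of an i.i.d. sample $(Y_1,X_1),\dots,(Y_n,X_n)$ of $(Y,X)$ with values in $L^2[0,1]$; $\mathbb E_\beta$ is the expectation when the slope function is $\beta$. **Proposition.** (i) (polynomial case) Let $\upsilon_1=1$ and $\upsilon_j=j^{-2a}$, $j\ge 2$, for some $a>1/2$. Then there are $C>0$ and $N\in\mathbb N$, depending only on $p,s,a,d,\sigma,\rho$, such that for all $n\ge N$, all $X$ as above and every estimator $\widetilde\beta^{(s)}$, $$\sup_{\beta\in\mathcal W_p^\rho}\mathbb E_\beta\bigl\|\widetilde\beta^{(s)}-\beta^{(s)}\bigr\|^2\ \ge\ C\,n^{-(2p-2s)/(2p+2a+1)} .$$ (ii) (exponential case) Let $\upsilon_1=1$ and $\upsilon_j=\exp(-j^{2a})$, $j\ge 2$, for some $a>0$. Then there are $C>0$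 and $N\in\mathbb N$, depending only on $p,s,a,d,\sigma,\rho$, such that for all $n\ge N$, all $X$ as above and every estimator $\widetilde\beta^{(s)}$, $$\sup_{\beta\in\mathcal W_p^\rho}\mathbb E_\beta\bigl\|\widetilde\beta^{(s)}-\beta^{(s)}\bigr\|^2\ \ge\ C\,(\log n)^{-(p-s)/a} .$$ -/

import Mathlib

open MeasureTheory ProbabilityTheory Set
open scoped ENNReal RealInnerProductSpace

namespace FunctionalLinearModel

/-- The real Hilbert space `L²[0,1]`. -/
abbrev L2 : Type := Lp ℝ 2 ((volume : Measure ℝ).restrict (Icc 0 1))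

/-- `L²[0,1]` carries its Borel σ-algebra. -/
noncomputable instance instMeasurableSpaceL2 : MeasurableSpace L2 := borel L2

instance instBorelSpaceL2 : BorelSpace L2 := ⟨rfl⟩

/-- The trigonometric functions, enumerated from `1`: `ψ₁ = 1`, `ψ₂ⱼ(t) = √2 cos (2πjt)`,
`ψ₂ⱼ₊₁(t) = √2 sin (2πjt)` for `j ≥ 1` (here `j / 2` is division of natural numbers; the index
`0` is never used). -/
noncomputable def trigFun (j : ℕ) (t : ℝ) : ℝ :=
  if j ≤ 1 then 1
  else if Even j then √2 * Real.cos (2 * Real.pi * ((j / 2 : ℕ) : ℝ) * t)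
  else √2 * Real.sin (2 * Real.pi * ((j / 2 : ℕ) : ℝ) * t)

theorem continuous_trigFun (j : ℕ) : Continuous (trigFun j) := by
  unfold trigFun
  split_ifs <;> fun_prop

theorem abs_trigFun_le (j : ℕ) (t : ℝ) : |trigFun j t| ≤ √2 := by
  have h1 : (1 : ℝ) ≤ √2 := Real.one_le_sqrt.2 (by norm_num)
  unfold trigFun
  split_ifs
  · simp
  · rw [abs_mul, abs_of_nonneg (Real.sqrt_nonneg 2)]
    exact mul_le_of_le_one_right (Real.sqrt_nonneg 2) (Real.abs_cos_le_one _)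
  · rw [abs_mul, abs_of_nonneg (Real.sqrt_nonneg 2)]
    exact mul_le_of_le_one_right (Real.sqrt_nonneg 2) (Real.abs_sin_le_one _)

theorem memLp_trigFun (j : ℕ) :
    MemLp (trigFun j) 2 ((volume : Measure ℝ).restrict (Icc 0 1)) :=
  MemLp.of_bound (continuous_trigFun j).aestronglyMeasurable (√2)
    (Filter.Eventually.of_forall (abs_trigFun_le j))

/-- The trigonometric basis `(ψⱼ)_{j ≥ 1}` as elements of `L²[0,1]`. -/
noncomputable def trig (j : ℕ) : L2 := (memLp_trigFun j).toLp (trigFun j)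

/-- The squared weighted norm `‖f‖²_w = ∑_{j ≥ 1} wⱼ ⟨f, ψⱼ⟩²`, possibly `∞`. -/
noncomputable def weightedNormSq (w : ℕ → ℝ) (f : L2) : ℝ≥0∞ :=
  ∑' j : ℕ, ENNReal.ofReal (w (j + 1) * ⟪f, trig (j + 1)⟫ ^ 2)

/-- The Sobolev weights of order `p`: `w₁ = 1` and `w₂ⱼ = w₂ⱼ₊₁ = j^{2p}` for `j ≥ 1`. -/
noncomputable def sobolevWeight (p : ℝ) (j : ℕ) : ℝ :=
  if j ≤ 1 then 1 else ((j / 2 : ℕ) : ℝ) ^ (2 * p)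

/-- The ellipsoid `W_p^ρ = {f ∈ L²[0,1] : ‖f‖²_{w^p} ≤ ρ}` in the Sobolev space of periodic
functions. -/
def sobolevEllipsoid (p ρ : ℝ) : Set L2 :=
  {f | weightedNormSq (sobolevWeight p) f ≤ ENNReal.ofReal ρ}

/-- `g` is the `s`-th weak derivative of `f` on `(0,1)`. -/
def IsWeakDeriv (s : ℕ) (f g : L2) : Prop :=
  ∀ φ : ℝ → ℝ, ContDiff ℝ (⊤ : ℕ∞) φ → HasCompactSupport φ → tsupport φ ⊆ Ioo 0 1 →
    ∫ t in Icc (0 : ℝ) 1, f t * iteratedDeriv s φ t =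
      (-1) ^ s * ∫ t in Icc (0 : ℝ) 1, g t * φ t

/-- Polynomially decreasing weights: `υ₁ = 1` and `υⱼ = j^{-2a}` for `j ≥ 2`. -/
noncomputable def polyWeight (a : ℝ) (j : ℕ) : ℝ :=
  if j ≤ 1 then 1 else (j : ℝ) ^ (-(2 * a))

/-- Exponentially decreasing weights: `υ₁ = 1` and `υⱼ = exp (-j^{2a})` for `j ≥ 2`. -/
noncomputable def expWeight (a : ℝ) (j : ℕ) : ℝ :=
  if j ≤ 1 then 1 else Real.exp (-((j : ℝ) ^ (2 * a)))

/-- The set `S_υ^d` of the sequences `(λⱼ)_{j ≥ 1}` with `1/d ≤ λⱼ/υⱼ ≤ d` for all `j ≥ 1`. -/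
def linkClass (υ : ℕ → ℝ) (d : ℝ) : Set (ℕ → ℝ) :=
  {lam | ∀ j : ℕ, 1 ≤ j → 1 / d ≤ lam j / υ j ∧ lam j / υ j ≤ d}

/-- `μ` is the law of a centered random function `X` in `L²[0,1]` with `E‖X‖² < ∞`, whose
covariance operator `T f = E[⟨f, X⟩ X]` has the trigonometric functions `ψⱼ` as eigenfunctions,
with associated sequence of eigenvalues `(λⱼ)_{j ≥ 1}`. This spectral decomposition is the sense
in which `X` is second order stationary; for a covariance kernel `c(t - s)` with `c` of
period `1` it always holds. -/
structure IsRegressorLaw (μ : Measure L2) (lam : ℕ → ℝ) : Prop where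
  isProbabilityMeasure : IsProbabilityMeasure μ
  memLp_two : MemLp id 2 μ
  centered : ∫ x, x ∂μ = 0
  eigen : ∀ j : ℕ, 1 ≤ j → covarianceOperator μ (trig j) = lam j • trig j

/-- The law of one observation `(Y, X)` with `Y = ∫₀¹ β(t) X(t) dt + σ ε`, where `X` has law `μ`
and `ε ∼ N(0,1)` is independent of `X`. -/
noncomputable def obsLaw (μ : Measure L2) (σ : ℝ) (β : L2) : Measure (ℝ × L2) :=
  (μ.prod (gaussianReal 0 1)).map (fun z : L2 × ℝ => (⟪β, z.1⟫ + σ * z.2, z.1))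

/-- The joint law of an i.i.d. sample `(Y₁, X₁), …, (Yₙ, Xₙ)` with slope function `β`. -/
noncomputable def sampleLaw (μ : Measure L2) (σ : ℝ) (β : L2) (n : ℕ) :
    Measure (Fin n → ℝ × L2) :=
  Measure.pi (fun _ => obsLaw μ σ β)

/-- The maximal `L²`-risk `sup_{β ∈ W_p^ρ} E ‖T - β^{(s)}‖²` of an estimator `T` of the `s`-th weak
derivative, i.e. of a function `T` of the sample with values in `L²[0,1]`; `g` stands for the weak
derivative `β^{(s)}`. -/
noncomputable def maxRisk (μ : Measure L2) (σ p ρ : ℝ) (s n : ℕ)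
    (T : (Fin n → ℝ × L2) → L2) : ℝ≥0∞ :=
  ⨆ β ∈ sobolevEllipsoid p ρ, ⨆ g : L2, ⨆ _ : IsWeakDeriv s β g,
    ∫⁻ z, ‖T z - g‖ₑ ^ 2 ∂(sampleLaw μ σ β n)

end FunctionalLinearModel

namespace FunctionalLinearModel

/-! The proof is Assouad's method on a cube of slopes `b ∑ ±ψ_{2j}`, `j ∈ F`, built from cosines
only. Differentiating `s` times multiplies the `j`-th cosine by `(2πj)^s` and shifts its phase by
`sπ/2`. The shifted waves are still orthonormal, so by Bessel the risk dominates the sum over `j` of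
the risks of guessing the sign of the coordinate `±b(2πj)^s`.

Each sign is hard to guess if `n b² λ_{2j} ≤ σ²`. Relative to the midpoint of two vertices differing
in one sign, their likelihood ratios are `exp(±W - H/2)`, with `W = ∑ h(Xᵢ)εᵢ`, `H = ∑ h(Xᵢ)²` and
`h = ⟨δ,·⟩/σ`. Both `E H` and `E W²` are at most 1, so the two risks add up to at least `2c²e⁻²`
(`two_point_lower_bound`). Averaging over the cube gives `e⁻² ∑ (b(2πj)^s)²` (`cube_lower_bound`).

It remains to choose `F` and `b`. Polynomial case: `F = [k, 2k)` with `k ≈ n^{1/(2p+2a+1)}` and `b²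
≈ k^{-2p-1}`. Exponential case: the single frequency `k ≈ (log n)^{1/(2a)}` with `b² ≈ k^{-2p}`
suffices. -/

/-! ### Likelihood ratios of Gaussian samples -/

/-- It suffices to compare measurable boxes. There the integrand factors over the coordinates, which
are independent under the product measure. -/
theorem pi_withDensity {ι Ω : Type*} [Fintype ι] [MeasurableSpace Ω] (m : Measure Ω)
    [IsProbabilityMeasure m] {f : Ω → ℝ≥0∞} (hf : Measurable f)
    [IsProbabilityMeasure (m.withDensity f)] :
    Measure.pi (fun _ : ι => m.withDensity f) =
      (Measure.pi (fun _ : ι => m)).withDensity (fun z => ∏ i, f (z i)) := by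
  refine Measure.pi_eq fun s hs => ?_
  rw [withDensity_apply _ (MeasurableSet.univ_pi hs),
    ← lintegral_indicator (MeasurableSet.univ_pi hs)]
  have hmeas : ∀ i, Measurable ((s i).indicator f) := fun i => hf.indicator (hs i)
  have hprod : ∀ z : ι → Ω, (univ.pi s).indicator (fun z => ∏ i, f (z i)) z =
      ∏ i, (s i).indicator f (z i) := by
    intro z
    by_cases hz : z ∈ univ.pi s
    · rw [indicator_of_mem hz]
      exact Finset.prod_congr rfl fun i _ => (indicator_of_mem (hz i (mem_univ i)) f).symm
    · rw [indicator_of_notMem hz]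
      simp only [mem_pi, mem_univ, true_implies, not_forall] at hz
      obtain ⟨i, hi⟩ := hz
      exact (Finset.prod_eq_zero (Finset.mem_univ i) (indicator_of_notMem hi f)).symm
  simp_rw [hprod]
  rw [lintegral_prod_eq_prod_lintegral_of_indepFun Finset.univ _
    (iIndepFun_pi (μ := fun _ : ι => m) (X := fun i => (s i).indicator f)
      fun i => (hmeas i).aemeasurable) fun i => (hmeas i).comp (measurable_pi_apply i)]
  refine Finset.prod_congr rfl fun i _ => ?_
  rw [withDensity_apply _ (hs i), ← lintegral_indicator (hs i),
    ← lintegral_map (hmeas i) (measurable_pi_apply i), (measurePreserving_eval _ i).map_eq]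

theorem lintegral_gaussianReal_add (y : ℝ) {f : ℝ → ℝ≥0∞} (hf : Measurable f) :
    ∫⁻ e, f (e + y) ∂gaussianReal 0 1 =
      ∫⁻ e, ENNReal.ofReal (Real.exp (y * e - y ^ 2 / 2)) * f e ∂gaussianReal 0 1 := by
  have h1 : (gaussianReal 0 1).map (· + y) = gaussianReal y 1 := by
    rw [gaussianReal_map_add_const, zero_add]
  rw [← lintegral_map hf (measurable_add_const y), h1,
    gaussianReal_of_var_ne_zero _ one_ne_zero, gaussianReal_of_var_ne_zero _ one_ne_zero,
    lintegral_withDensity_eq_lintegral_mul _ (measurable_gaussianPDF _ _) hf,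
    lintegral_withDensity_eq_lintegral_mul _ (measurable_gaussianPDF _ _) (by fun_prop)]
  refine lintegral_congr fun e => ?_
  simp only [Pi.mul_apply]
  rw [← mul_assoc, gaussianPDF, gaussianPDF, ← ENNReal.ofReal_mul (gaussianPDFReal_nonneg _ _ _),
    gaussianPDFReal, gaussianPDFReal, mul_assoc _ (Real.exp _) (Real.exp _), ← Real.exp_add]
  congr 5
  simp only [NNReal.coe_one]
  ring

/-- The likelihood ratio of a Gaussian shift. -/
noncomputable def shiftDensity (y e : ℝ) : ℝ≥0∞ := ENNReal.ofReal (Real.exp (y * e - y ^ 2 / 2))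

theorem map_shift_prod_gaussianReal {E : Type*} [MeasurableSpace E] (μ : Measure E)
    [IsProbabilityMeasure μ] {h : E → ℝ} (hh : Measurable h) :
    (μ.prod (gaussianReal 0 1)).map (fun z : E × ℝ => (z.1, z.2 + h z.1)) =
      (μ.prod (gaussianReal 0 1)).withDensity (fun z => shiftDensity (h z.1) z.2) := by
  refine Measure.ext_of_lintegral _ fun f hf => ?_
  have hd : Measurable fun z : E × ℝ => shiftDensity (h z.1) z.2 := by
    unfold shiftDensity; fun_prop
  rw [lintegral_map hf (by fun_prop), lintegral_withDensity_eq_lintegral_mul _ hd hf,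
    lintegral_prod _ (by fun_prop), lintegral_prod _ (hd.mul hf).aemeasurable]
  refine lintegral_congr fun x => ?_
  exact lintegral_gaussianReal_add (h x) (f := fun e => f (x, e)) (by fun_prop)

theorem measurable_inner_left (β : L2) : Measurable fun x : L2 => ⟪β, x⟫ :=
  (continuous_const.inner continuous_id).measurable

theorem measurable_obs (σ : ℝ) (β : L2) :
    Measurable (fun z : L2 × ℝ => (⟪β, z.1⟫ + σ * z.2, z.1)) :=
  (((measurable_inner_left β).comp measurable_fst).add (measurable_snd.const_mul σ)).prodMk
    measurable_fst

/-- Since `⟨β+δ,x⟩ + σe = ⟨β,x⟩ + σ(e + ⟨δ,x⟩/σ)`, changing the slope amounts to shifting the noise,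
hence to reweighting it. The observation map keeps slope `β`, so the laws for `δ` and `-δ` live on
one noise space. -/
theorem sampleLaw_add (μ : Measure L2) [IsProbabilityMeasure μ] {σ : ℝ} (hσ : σ ≠ 0) (β δ : L2)
    (n : ℕ) :
    sampleLaw μ σ (β + δ) n =
      ((Measure.pi fun _ : Fin n => μ.prod (gaussianReal 0 1)).withDensity
        (fun z => ∏ i, shiftDensity (⟪δ, (z i).1⟫ / σ) (z i).2)).map
        (fun z i => (⟪β, (z i).1⟫ + σ * (z i).2, (z i).1)) := by
  have hm : Measurable fun x : L2 => ⟪δ, x⟫ / σ := (measurable_inner_left δ).div_const σ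
  have hd : Measurable fun z : L2 × ℝ => shiftDensity (⟪δ, z.1⟫ / σ) z.2 := by
    unfold shiftDensity; fun_prop
  have hs : Measurable fun z : L2 × ℝ => (z.1, z.2 + ⟪δ, z.1⟫ / σ) := by fun_prop
  have hshift := map_shift_prod_gaussianReal μ hm
  have hprob : IsProbabilityMeasure ((μ.prod (gaussianReal 0 1)).withDensity
      (fun z => shiftDensity (⟪δ, z.1⟫ / σ) z.2)) := by
    rw [← hshift]
    exact Measure.isProbabilityMeasure_map hs.aemeasurable
  have hobs : obsLaw μ σ (β + δ) =
      ((μ.prod (gaussianReal 0 1)).withDensity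
        (fun z => shiftDensity (⟪δ, z.1⟫ / σ) z.2)).map
        (fun z : L2 × ℝ => (⟪β, z.1⟫ + σ * z.2, z.1)) := by
    rw [← hshift, Measure.map_map (measurable_obs σ β) hs, obsLaw]
    congr 1
    funext z
    simp only [Function.comp, inner_add_left]
    congr 1
    field_simp
    ring
  have hprob' : IsProbabilityMeasure (((μ.prod (gaussianReal 0 1)).withDensity
        (fun z => shiftDensity (⟪δ, z.1⟫ / σ) z.2)).map
        (fun z : L2 × ℝ => (⟪β, z.1⟫ + σ * z.2, z.1))) :=
    Measure.isProbabilityMeasure_map (measurable_obs σ β).aemeasurable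
  rw [sampleLaw, hobs, ← Measure.pi_map_pi fun _ => (measurable_obs σ β).aemeasurable,
    pi_withDensity _ hd]

/-! ### The two-point inequality before integration -/

/-- The tangent of the convex function `exp(-z)` at `z = 2` replaces Jensen's inequality. -/
theorem exp_neg_ge_tangent (z : ℝ) : Real.exp (-2) * (3 - z) ≤ Real.exp (-z) := by
  have h : Real.exp (-z) = Real.exp (-2) * Real.exp (2 - z) := by
    rw [← Real.exp_add]; congr 1; ring
  rw [h]
  exact mul_le_mul_of_nonneg_left (by linarith [Real.add_one_le_exp (2 - z)]) (Real.exp_pos _).le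

/-- Both weights are at least `exp(-z)`, because `|W| ≤ (1 + W²)/2`, and `(t-c)² + (t+c)² ≥ 2c²`.
The left side is affine in `H` and `W²`, so integrating it needs second moments only. -/
theorem weighted_sq_add_ge (t c W H : ℝ) :
    2 * c ^ 2 * (Real.exp (-2) * (3 - (H / 2 + (1 + W ^ 2) / 2))) ≤
      Real.exp (W - H / 2) * (t - c) ^ 2 + Real.exp (-W - H / 2) * (t + c) ^ 2 := by
  have hW : |W| ≤ (1 + W ^ 2) / 2 := by nlinarith [sq_nonneg (|W| - 1), sq_abs W]
  set z := H / 2 + (1 + W ^ 2) / 2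
  have h0 := exp_neg_ge_tangent z
  have h1 : Real.exp (-z) ≤ Real.exp (W - H / 2) :=
    Real.exp_le_exp.2 (by simp only [z]; linarith [neg_abs_le W])
  have h2 : Real.exp (-z) ≤ Real.exp (-W - H / 2) :=
    Real.exp_le_exp.2 (by simp only [z]; linarith [le_abs_self W])
  calc _ ≤ 2 * c ^ 2 * Real.exp (-z) := by gcongr
    _ ≤ Real.exp (-z) * (t - c) ^ 2 + Real.exp (-z) * (t + c) ^ 2 := by
        nlinarith [mul_nonneg (Real.exp_pos (-z)).le (sq_nonneg t)]
    _ ≤ _ := by gcongr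

theorem prod_shiftDensity {ι : Type*} [Fintype ι] (y e : ι → ℝ) :
    ∏ i, shiftDensity (y i) (e i) =
      ENNReal.ofReal (Real.exp (∑ i, y i * e i - (∑ i, y i ^ 2) / 2)) := by
  simp only [shiftDensity]
  rw [← ENNReal.ofReal_prod_of_nonneg fun i _ => (Real.exp_pos _).le, ← Real.exp_sum,
    Finset.sum_sub_distrib, Finset.sum_div]

/-- Needed because the tangent bound can be negative; pass to the positive part. -/
theorem ofReal_integral_le_lintegral_ofReal {Ω : Type*} [MeasurableSpace Ω] {m : Measure Ω}
    {f : Ω → ℝ} (hf : Integrable f m) :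
    ENNReal.ofReal (∫ x, f x ∂m) ≤ ∫⁻ x, ENNReal.ofReal (f x) ∂m := by
  calc _ ≤ ENNReal.ofReal (∫ x, max (f x) 0 ∂m) :=
        ENNReal.ofReal_le_ofReal (integral_mono hf hf.pos_part fun x => le_max_left _ _)
    _ = ∫⁻ x, ENNReal.ofReal (max (f x) 0) ∂m :=
        ofReal_integral_eq_lintegral_ofReal hf.pos_part (ae_of_all _ fun x => le_max_right _ _)
    _ = _ := by simp

theorem memLp_mul_gaussianReal {E : Type*} [MeasurableSpace E] (μ : Measure E) {h : E → ℝ}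
    (hh : MemLp h 2 μ) :
    MemLp (fun z : E × ℝ => h z.1 * z.2) 2 (μ.prod (gaussianReal 0 1)) := by
  have hg : MemLp (id : ℝ → ℝ) 2 (gaussianReal 0 1) := memLp_id_gaussianReal 2
  refine (memLp_two_iff_integrable_sq
    (hh.aestronglyMeasurable.comp_fst.mul measurable_snd.aestronglyMeasurable)).2 ?_
  simpa [mul_pow] using hh.integrable_sq.mul_prod hg.integrable_sq

/-! ### Second moments of the log-likelihood ratio -/

section Moments

variable {E : Type*} [MeasurableSpace E] (μ : Measure E) [IsProbabilityMeasure μ] {h : E → ℝ}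

theorem integrable_sum_sq (hh : MemLp h 2 μ) (n : ℕ) :
    Integrable (fun z : Fin n → E × ℝ => ∑ i, h (z i).1 ^ 2)
      (Measure.pi fun _ => μ.prod (gaussianReal 0 1)) := by
  refine integrable_finsetSum _ fun i _ => ?_
  exact integrable_comp_eval (X := fun _ : Fin n => E × ℝ)
    (μ := fun _ => μ.prod (gaussianReal 0 1)) (f := fun z => h z.1 ^ 2)
    (hh.integrable_sq.comp_fst (gaussianReal 0 1))

theorem integral_sum_sq (hh : MemLp h 2 μ) (n : ℕ) :
    ∫ z : Fin n → E × ℝ, ∑ i, h (z i).1 ^ 2 ∂(Measure.pi fun _ => μ.prod (gaussianReal 0 1)) =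
      n * ∫ x, h x ^ 2 ∂μ := by
  have hi := hh.integrable_sq.comp_fst (gaussianReal 0 1)
  rw [integral_finsetSum]
  · have : ∀ i : Fin n, ∫ z : Fin n → E × ℝ, h (z i).1 ^ 2
        ∂(Measure.pi fun _ => μ.prod (gaussianReal 0 1)) = ∫ x, h x ^ 2 ∂μ := by
      intro i
      rw [integral_comp_eval (X := fun _ : Fin n => E × ℝ)
        (μ := fun _ => μ.prod (gaussianReal 0 1)) (f := fun z => h z.1 ^ 2)
        hi.aestronglyMeasurable, integral_fun_fst (fun x => h x ^ 2)]
      simp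
    simp [this]
  · intro i _
    exact integrable_comp_eval (X := fun _ : Fin n => E × ℝ)
      (μ := fun _ => μ.prod (gaussianReal 0 1)) (f := fun z => h z.1 ^ 2) hi

theorem integral_mul_gaussianReal_sq :
    ∫ z : E × ℝ, (h z.1 * z.2) ^ 2 ∂(μ.prod (gaussianReal 0 1)) = ∫ x, h x ^ 2 ∂μ := by
  have h2 : ∫ x : ℝ, x ^ 2 ∂gaussianReal 0 1 = 1 := by
    have h := variance_id_gaussianReal (μ := 0) (v := 1)
    rw [variance_eq_integral aemeasurable_id] at h
    simpa using h
  simp_rw [mul_pow]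
  rw [integral_prod_mul (fun x => h x ^ 2) (fun e : ℝ => e ^ 2), h2, mul_one]

theorem integral_mul_gaussianReal :
    ∫ z : E × ℝ, h z.1 * z.2 ∂(μ.prod (gaussianReal 0 1)) = 0 := by
  rw [integral_prod_mul h (fun e : ℝ => e), integral_id_gaussianReal, mul_zero]

theorem memLp_sum_mul (hh : MemLp h 2 μ) (n : ℕ) :
    MemLp (fun z : Fin n → E × ℝ => ∑ i, h (z i).1 * (z i).2) 2
      (Measure.pi fun _ => μ.prod (gaussianReal 0 1)) :=
  memLp_finsetSum _ fun i _ => (memLp_mul_gaussianReal μ hh).comp_measurePreserving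
    (measurePreserving_eval (fun _ : Fin n => μ.prod (gaussianReal 0 1)) i)

/-- The summands are independent and centered, since the noise has mean zero, so their variances add
up; each equals `E h²` because the noise has unit variance. -/
theorem integral_sum_mul_sq (hh : MemLp h 2 μ) (n : ℕ) :
    ∫ z : Fin n → E × ℝ, (∑ i, h (z i).1 * (z i).2) ^ 2
      ∂(Measure.pi fun _ => μ.prod (gaussianReal 0 1)) = n * ∫ x, h x ^ 2 ∂μ := by
  have hL := memLp_mul_gaussianReal μ hh
  have hmean : ∫ z : Fin n → E × ℝ, ∑ i, h (z i).1 * (z i).2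
      ∂(Measure.pi fun _ => μ.prod (gaussianReal 0 1)) = 0 := by
    rw [integral_finsetSum]
    · refine Finset.sum_eq_zero fun i _ => ?_
      rw [integral_comp_eval (X := fun _ : Fin n => E × ℝ)
        (μ := fun _ => μ.prod (gaussianReal 0 1)) (f := fun z => h z.1 * z.2)
        hL.aestronglyMeasurable, integral_mul_gaussianReal]
    · intro i _
      exact integrable_comp_eval (X := fun _ : Fin n => E × ℝ)
        (μ := fun _ => μ.prod (gaussianReal 0 1)) (f := fun z => h z.1 * z.2)
        (hL.integrable one_le_two)
  have hvar := variance_sum_pi (μ := fun _ : Fin n => μ.prod (gaussianReal 0 1))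
    (X := fun _ z => h z.1 * z.2) fun _ => hL
  have hfun : (∑ i, fun z : Fin n → E × ℝ => h (z i).1 * (z i).2) =
      fun z => ∑ i, h (z i).1 * (z i).2 := by
    funext z; simp
  rw [hfun, variance_of_integral_eq_zero (memLp_sum_mul μ hh n).aestronglyMeasurable.aemeasurable
    hmean] at hvar
  rw [hvar]
  simp_rw [variance_of_integral_eq_zero hL.aestronglyMeasurable.aemeasurable
    (integral_mul_gaussianReal μ), integral_mul_gaussianReal_sq]
  simp

end Moments

/-- Two-point lower bound: estimating `±c` from samples with slopes `β ± δ`. -/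
theorem two_point_lower_bound (μ : Measure L2) [IsProbabilityMeasure μ] {σ : ℝ} (hσ : σ ≠ 0)
    (β δ : L2) (n : ℕ) (hδ : MemLp (fun x => ⟪δ, x⟫) 2 μ)
    (hn : n * ∫ x, ⟪δ, x⟫ ^ 2 ∂μ ≤ σ ^ 2) (c : ℝ) {t : (Fin n → ℝ × L2) → ℝ}
    (ht : Measurable t) :
    ENNReal.ofReal (2 * c ^ 2 * Real.exp (-2)) ≤
      ∫⁻ z, ENNReal.ofReal ((t z - c) ^ 2) ∂sampleLaw μ σ (β + δ) n +
        ∫⁻ z, ENNReal.ofReal ((t z + c) ^ 2) ∂sampleLaw μ σ (β - δ) n := by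
  set h : L2 → ℝ := fun x => ⟪δ, x⟫ / σ with hh
  have hmeas : Measurable h := (measurable_inner_left δ).div_const σ
  have hL : MemLp h 2 μ := by
    simpa [hh, div_eq_inv_mul] using hδ.const_mul σ⁻¹
  have hH : n * ∫ x, h x ^ 2 ∂μ ≤ 1 := by
    simp_rw [hh, div_pow]
    rw [integral_div, ← mul_div_assoc]
    exact div_le_one_of_le₀ hn (sq_nonneg σ)
  set Φ : (Fin n → L2 × ℝ) → (Fin n → ℝ × L2) :=
    fun z i => (⟪β, (z i).1⟫ + σ * (z i).2, (z i).1)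
  have hΦ : Measurable Φ :=
    measurable_pi_lambda _ fun i => (measurable_obs σ β).comp (measurable_pi_apply i)
  set H : (Fin n → L2 × ℝ) → ℝ := fun z => ∑ i, h (z i).1 ^ 2
  set W : (Fin n → L2 × ℝ) → ℝ := fun z => ∑ i, h (z i).1 * (z i).2
  have hHm : Measurable H := by fun_prop
  have hWm : Measurable W := by fun_prop
  set P := Measure.pi fun _ : Fin n => μ.prod (gaussianReal 0 1)
  -- Both risks are pulled back to the same noise space `P`; only the sign of `W` differs between
  -- them.
  have key1 : ∀ f : (Fin n → ℝ × L2) → ℝ, Measurable f →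
      ∫⁻ z, ENNReal.ofReal (f z) ∂sampleLaw μ σ (β + δ) n =
        ∫⁻ z, ENNReal.ofReal (Real.exp (W z - H z / 2) * f (Φ z)) ∂P := by
    intro f hf
    rw [sampleLaw_add μ hσ, lintegral_map (by fun_prop) hΦ]
    simp_rw [prod_shiftDensity]
    rw [lintegral_withDensity_eq_lintegral_mul _ (by fun_prop) (by fun_prop)]
    refine lintegral_congr fun z => ?_
    rw [Pi.mul_apply, ENNReal.ofReal_mul (Real.exp_pos _).le]
  have key2 : ∀ f : (Fin n → ℝ × L2) → ℝ, Measurable f →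
      ∫⁻ z, ENNReal.ofReal (f z) ∂sampleLaw μ σ (β - δ) n =
        ∫⁻ z, ENNReal.ofReal (Real.exp (-W z - H z / 2) * f (Φ z)) ∂P := by
    intro f hf
    rw [sub_eq_add_neg β δ, sampleLaw_add μ hσ, lintegral_map (by fun_prop) hΦ]
    simp_rw [prod_shiftDensity, inner_neg_left, neg_div, neg_mul, neg_sq, Finset.sum_neg_distrib]
    rw [lintegral_withDensity_eq_lintegral_mul _ (by fun_prop) (by fun_prop)]
    refine lintegral_congr fun z => ?_
    rw [Pi.mul_apply, ENNReal.ofReal_mul (Real.exp_pos _).le]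
  rw [key1 _ (by fun_prop), key2 _ (by fun_prop), ← lintegral_add_left (by fun_prop)]
  have hHi : Integrable H P := integrable_sum_sq μ hL n
  have hWi : Integrable (fun z => W z ^ 2) P := (memLp_sum_mul μ hL n).integrable_sq
  have hZ : Integrable (fun z => H z / 2 + (1 + W z ^ 2) / 2) P :=
    (hHi.div_const 2).add (((integrable_const 1).add hWi).div_const 2)
  have hint : Integrable (fun z =>
      2 * c ^ 2 * (Real.exp (-2) * (3 - (H z / 2 + (1 + W z ^ 2) / 2)))) P :=
    (((integrable_const 3).sub hZ).const_mul _).const_mul _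
  -- The mean is in fact at most 3/2; 2 is the point of tangency.
  have hval : ∫ z, (H z / 2 + (1 + W z ^ 2) / 2) ∂P ≤ 2 := by
    have hW1 : Integrable (fun z => 1 + W z ^ 2) P := (integrable_const 1).add hWi
    rw [integral_add (hHi.div_const 2) (hW1.div_const 2), integral_div, integral_div, integral_add (integrable_const 1) hWi,
      integral_sum_sq μ hL n, integral_sum_mul_sq μ hL n]
    simp
    linarith
  calc _ ≤ ENNReal.ofReal (∫ z,
          2 * c ^ 2 * (Real.exp (-2) * (3 - (H z / 2 + (1 + W z ^ 2) / 2))) ∂P) := by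
        refine ENNReal.ofReal_le_ofReal ?_
        rw [integral_const_mul, integral_const_mul, integral_sub (integrable_const 3) hZ]
        refine mul_le_mul_of_nonneg_left ?_ (by positivity)
        simp only [integral_const, probReal_univ, one_smul]
        nlinarith [Real.exp_pos (-2)]
    _ ≤ _ := ofReal_integral_le_lintegral_ofReal hint
    _ ≤ _ := by
        refine lintegral_mono fun z => ?_
        rw [← ENNReal.ofReal_add (by positivity) (by positivity)]
        exact ENNReal.ofReal_le_ofReal (weighted_sq_add_ge _ c (W z) (H z))

/-! ### Trigonometric waves and their weak derivatives -/

/-- The wave `t ↦ √2 cos (2πjt + α)`. -/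
noncomputable def waveFun (j : ℕ) (α t : ℝ) : ℝ := √2 * Real.cos (2 * Real.pi * j * t + α)

theorem continuous_waveFun (j : ℕ) (α : ℝ) : Continuous (waveFun j α) := by
  unfold waveFun; fun_prop

theorem abs_waveFun_le (j : ℕ) (α t : ℝ) : |waveFun j α t| ≤ √2 := by
  rw [waveFun, abs_mul, abs_of_nonneg (Real.sqrt_nonneg 2)]
  exact mul_le_of_le_one_right (Real.sqrt_nonneg 2) (Real.abs_cos_le_one _)

theorem memLp_waveFun (j : ℕ) (α : ℝ) :
    MemLp (waveFun j α) 2 ((volume : Measure ℝ).restrict (Icc 0 1)) :=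
  MemLp.of_bound (continuous_waveFun j α).aestronglyMeasurable (√2)
    (Filter.Eventually.of_forall (abs_waveFun_le j α))

/-- The wave `t ↦ √2 cos (2πjt + α)` as an element of `L²[0,1]`. -/
noncomputable def wave (j : ℕ) (α : ℝ) : L2 := (memLp_waveFun j α).toLp (waveFun j α)

theorem coeFn_wave (j : ℕ) (α : ℝ) :
    wave j α =ᵐ[(volume : Measure ℝ).restrict (Icc 0 1)] waveFun j α := MemLp.coeFn_toLp _

theorem integral_Icc_cos_int {m : ℤ} (hm : m ≠ 0) (γ : ℝ) :
    ∫ t in Icc (0 : ℝ) 1, Real.cos (2 * Real.pi * m * t + γ) = 0 := by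
  rw [integral_Icc_eq_integral_Ioc, ← intervalIntegral.integral_of_le zero_le_one]
  have hc : (2 * Real.pi * m : ℝ) ≠ 0 := by
    have : (m : ℝ) ≠ 0 := by exact_mod_cast hm
    positivity
  rw [intervalIntegral.integral_comp_mul_add (fun t => Real.cos t) hc, integral_cos]
  have : Real.sin (2 * Real.pi * m * 1 + γ) = Real.sin γ := by
    rw [show 2 * Real.pi * m * 1 + γ = γ + m * (2 * Real.pi) by ring, Real.sin_add_int_mul_two_pi]
  rw [this]
  simp

theorem inner_toLp {f g : ℝ → ℝ} (hf : MemLp f 2 ((volume : Measure ℝ).restrict (Icc 0 1)))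
    (hg : MemLp g 2 ((volume : Measure ℝ).restrict (Icc 0 1))) :
    ⟪(hf.toLp f : L2), hg.toLp g⟫ = ∫ t in Icc (0 : ℝ) 1, f t * g t := by
  rw [L2.inner_def]
  refine integral_congr_ae ?_
  filter_upwards [hf.coeFn_toLp, hg.coeFn_toLp] with t h1 h2
  rw [h1, h2]
  simp [mul_comm]

theorem waveFun_mul (i j : ℕ) (α γ t : ℝ) :
    waveFun i α t * waveFun j γ t =
      Real.cos (2 * Real.pi * ((i - j : ℤ) : ℝ) * t + (α - γ)) +
        Real.cos (2 * Real.pi * ((i + j : ℤ) : ℝ) * t + (α + γ)) := by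
  have h2 : √2 * √2 = 2 := Real.mul_self_sqrt (by norm_num)
  have e1 : 2 * Real.pi * ((i - j : ℤ) : ℝ) * t + (α - γ) =
      (2 * Real.pi * i * t + α) - (2 * Real.pi * j * t + γ) := by push_cast; ring
  have e2 : 2 * Real.pi * ((i + j : ℤ) : ℝ) * t + (α + γ) =
      (2 * Real.pi * i * t + α) + (2 * Real.pi * j * t + γ) := by push_cast; ring
  rw [e1, e2, Real.cos_sub, Real.cos_add (2 * Real.pi * i * t + α), waveFun, waveFun]
  linear_combination Real.cos (2 * Real.pi * i * t + α) * Real.cos (2 * Real.pi * j * t + γ) * h2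

/-- By product-to-sum, only frequencies `i - j` and `i + j` occur. The second is nonzero as `j ≥ 1`
and integrates to zero over the period. -/
theorem inner_wave (i : ℕ) {j : ℕ} (hj : 1 ≤ j) (α γ : ℝ) :
    ⟪wave i α, wave j γ⟫ = if i = j then Real.cos (α - γ) else 0 := by
  rw [wave, wave, inner_toLp]
  simp_rw [waveFun_mul]
  rw [integral_add (Continuous.integrableOn_Icc (by fun_prop))
    (Continuous.integrableOn_Icc (by fun_prop)), integral_Icc_cos_int (m := i + j) (by omega), add_zero]
  split_ifs with h
  · subst h; simp
  · exact integral_Icc_cos_int (by omega) _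

theorem trig_two_mul {j : ℕ} (hj : 1 ≤ j) : trig (2 * j) = wave j 0 := by
  refine MemLp.toLp_congr _ _ (ae_of_all _ fun t => ?_)
  have h1 : ¬ 2 * j ≤ 1 := by omega
  simp [trigFun, waveFun, h1]

theorem trig_two_mul_add_one {j : ℕ} (hj : 1 ≤ j) : trig (2 * j + 1) = wave j (-(Real.pi / 2)) := by
  refine MemLp.toLp_congr _ _ (ae_of_all _ fun t => ?_)
  have h1 : ¬ 2 * j + 1 ≤ 1 := by omega
  have h2 : ¬ Even (2 * j + 1) := by simp
  have h3 : (2 * j + 1) / 2 = j := by omega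
  rw [trigFun, if_neg h1, if_neg h2, h3, waveFun, ← sub_eq_add_neg, Real.cos_sub_pi_div_two]

theorem inner_trig_one_wave {j : ℕ} (hj : 1 ≤ j) (α : ℝ) : ⟪trig 1, wave j α⟫ = 0 := by
  rw [trig, wave, inner_toLp]
  have h := integral_Icc_cos_int (m := j) (by omega) α
  simp only [trigFun, le_refl, if_true, waveFun, one_mul, integral_const_mul]
  simp only [Int.cast_natCast] at h
  rw [h, mul_zero]

theorem inner_wave_trig {i : ℕ} (hi : 1 ≤ i) {l : ℕ} (hl : 1 ≤ l) :
    ⟪wave i 0, trig l⟫ = if l = 2 * i then 1 else 0 := by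
  obtain rfl | hl1 := hl.eq_or_lt
  · rw [real_inner_comm, inner_trig_one_wave hi, if_neg (by omega)]
  obtain ⟨j, rfl | rfl⟩ := l.even_or_odd'
  · rw [trig_two_mul (by omega), inner_wave _ (by omega)]
    simp [eq_comm]
  · rw [trig_two_mul_add_one (by omega), inner_wave _ (by omega), if_neg (show ¬ 2 * j + 1 = 2 * i by omega)]
    simp

theorem orthonormal_wave (α : ℝ) (F : Finset ℕ) (hF : ∀ j ∈ F, 1 ≤ j) :
    Orthonormal ℝ (fun j : F => wave j α) := by
  rw [orthonormal_iff_ite]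
  intro i j
  rw [inner_wave _ (hF j j.2)]
  rw [sub_self, Real.cos_zero]
  exact if_congr Subtype.ext_iff.symm rfl rfl

theorem integral_wave_mul (j : ℕ) (α : ℝ) (φ : ℝ → ℝ) :
    ∫ t in Icc (0 : ℝ) 1, wave j α t * φ t = ∫ t in Icc (0 : ℝ) 1, waveFun j α t * φ t := by
  refine integral_congr_ae ?_
  filter_upwards [coeFn_wave j α] with t ht
  rw [ht]

theorem hasDerivAt_waveFun (j : ℕ) (α t : ℝ) :
    HasDerivAt (waveFun j α) (2 * Real.pi * j * waveFun j (α + Real.pi / 2) t) t := by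
  have h : HasDerivAt (fun t : ℝ => 2 * Real.pi * j * t + α) (2 * Real.pi * j) t := by
    simpa using ((hasDerivAt_id t).const_mul (2 * Real.pi * j)).add_const α
  have h2 := (h.cos).const_mul (√2)
  refine h2.congr_deriv ?_
  rw [waveFun, ← add_assoc, Real.cos_add_pi_div_two]
  ring

/-- Repeated integration by parts: `φ` vanishes at 0 and 1, and each derivative of a wave is a phase
shift by `π/2` times `2πj`. -/
theorem integral_waveFun_mul_iteratedDeriv (j s : ℕ) (α : ℝ) (φ : ℝ → ℝ)
    (hφ : ContDiff ℝ (⊤ : ℕ∞) φ) (hs : tsupport φ ⊆ Ioo 0 1) :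
    ∫ t in Icc (0 : ℝ) 1, waveFun j α t * iteratedDeriv s φ t =
      (-1) ^ s * ((2 * Real.pi * j) ^ s *
        ∫ t in Icc (0 : ℝ) 1, waveFun j (α + s * (Real.pi / 2)) t * φ t) := by
  induction s generalizing φ with
  | zero => simp
  | succ s ih =>
    have hd : ContDiff ℝ (⊤ : ℕ∞) (deriv φ) := (contDiff_infty_iff_deriv.1 hφ).2
    have hφd : Differentiable ℝ φ := (contDiff_infty_iff_deriv.1 hφ).1
    have hz : ∀ x, x ∉ Ioo (0 : ℝ) 1 → φ x = 0 := fun x hx =>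
      image_eq_zero_of_notMem_tsupport fun h => hx (hs h)
    have hparts : ∫ t in Icc (0 : ℝ) 1, waveFun j (α + s * (Real.pi / 2)) t * deriv φ t =
        -(2 * Real.pi * j * ∫ t in Icc (0 : ℝ) 1,
          waveFun j (α + (s + 1 : ℕ) * (Real.pi / 2)) t * φ t) := by
      rw [integral_Icc_eq_integral_Ioc, integral_Icc_eq_integral_Ioc,
        ← intervalIntegral.integral_of_le zero_le_one,
        ← intervalIntegral.integral_of_le zero_le_one,
        intervalIntegral.integral_mul_deriv_eq_deriv_mul
          (fun x _ => hasDerivAt_waveFun j _ x) (fun x _ => (hφd x).hasDerivAt)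
          (((continuous_waveFun j _).const_mul _).intervalIntegrable _ _)
          (hd.continuous.intervalIntegrable _ _),
        hz 0 (by simp), hz 1 (by simp), ← intervalIntegral.integral_const_mul]
      have e : α + s * (Real.pi / 2) + Real.pi / 2 = α + (s + 1 : ℕ) * (Real.pi / 2) := by
        push_cast; ring
      simp [e, mul_assoc]
    rw [iteratedDeriv_succ', ih _ hd ((tsupport_deriv_subset ).trans hs), hparts]
    ring

theorem isWeakDeriv_wave (j s : ℕ) (α : ℝ) :
    IsWeakDeriv s (wave j α) ((2 * Real.pi * j) ^ s • wave j (α + s * (Real.pi / 2))) := by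
  intro φ hφ _ hs
  rw [integral_wave_mul, integral_waveFun_mul_iteratedDeriv j s α φ hφ hs, ← integral_const_mul]
  congr 1
  refine integral_congr_ae ?_
  filter_upwards [coeFn_wave j (α + s * (Real.pi / 2)),
    Lp.coeFn_smul ((2 * Real.pi * j) ^ s) (wave j (α + s * (Real.pi / 2)))] with t h1 h2
  rw [h2, Pi.smul_apply, h1, smul_eq_mul]
  ring

theorem integrable_mul_continuous (f : L2) {φ : ℝ → ℝ} (hφ : Continuous φ) :
    Integrable (fun t => f t * φ t) ((volume : Measure ℝ).restrict (Icc 0 1)) := by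
  obtain ⟨C, hC⟩ := isCompact_Icc.exists_bound_of_continuousOn (hφ.continuousOn (s := Icc 0 1))
  have h : MemLp φ 2 ((volume : Measure ℝ).restrict (Icc 0 1)) :=
    MemLp.of_bound hφ.aestronglyMeasurable C ((ae_restrict_iff' measurableSet_Icc).2
      (ae_of_all _ hC))
  exact (Lp.memLp f).integrable_mul h

theorem IsWeakDeriv.smul {s : ℕ} {f g : L2} (h : IsWeakDeriv s f g) (c : ℝ) :
    IsWeakDeriv s (c • f) (c • g) := by
  intro φ hφ hc hs
  have e : ∀ (f : L2) (φ : ℝ → ℝ), ∫ t in Icc (0 : ℝ) 1, (c • f : L2) t * φ t =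
      c * ∫ t in Icc (0 : ℝ) 1, f t * φ t := by
    intro f φ
    rw [← integral_const_mul]
    refine integral_congr_ae ?_
    filter_upwards [Lp.coeFn_smul c f] with t ht
    rw [ht, Pi.smul_apply, smul_eq_mul, mul_assoc]
  rw [e, e, h φ hφ hc hs]
  ring

theorem IsWeakDeriv.add {s : ℕ} {f g f' g' : L2} (h : IsWeakDeriv s f g)
    (h' : IsWeakDeriv s f' g') : IsWeakDeriv s (f + f') (g + g') := by
  intro φ hφ hc hs
  have e : ∀ (f g : L2) (φ : ℝ → ℝ), Continuous φ →
      ∫ t in Icc (0 : ℝ) 1, (f + g : L2) t * φ t =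
        (∫ t in Icc (0 : ℝ) 1, f t * φ t) + ∫ t in Icc (0 : ℝ) 1, g t * φ t := by
    intro f g φ hφ
    rw [← integral_add (integrable_mul_continuous f hφ)
      (integrable_mul_continuous g hφ)]
    refine integral_congr_ae ?_
    filter_upwards [Lp.coeFn_add f g] with t ht
    rw [ht, Pi.add_apply, add_mul]
  rw [e _ _ _ (hφ.continuous_iteratedDeriv s (by exact_mod_cast le_top)), e _ _ _ hφ.continuous,
    h φ hφ hc hs, h' φ hφ hc hs]
  ring

theorem IsWeakDeriv.zero (s : ℕ) : IsWeakDeriv s 0 0 := by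
  have h := (isWeakDeriv_wave 0 s 0).smul 0
  simpa using h

theorem IsWeakDeriv.sum {ι : Type*} {s : ℕ} (F : Finset ι) {f g : ι → L2}
    (h : ∀ i ∈ F, IsWeakDeriv s (f i) (g i)) :
    IsWeakDeriv s (∑ i ∈ F, f i) (∑ i ∈ F, g i) := by
  classical
  induction F using Finset.induction_on with
  | empty => simpa using IsWeakDeriv.zero s
  | insert i F hi ih =>
    rw [Finset.sum_insert hi, Finset.sum_insert hi]
    exact (h i (Finset.mem_insert_self i F)).add
      (ih fun j hj => h j (Finset.mem_insert_of_mem hj))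

/-! ### Regressor moments and Assouad's cube -/

theorem memLp_inner {μ : Measure L2} (hμ : MemLp id 2 μ) (δ : L2) :
    MemLp (fun x => ⟪δ, x⟫) 2 μ := hμ.const_inner δ

theorem IsRegressorLaw.integral_inner_wave_sq {μ : Measure L2} {lam : ℕ → ℝ}
    (hμ : IsRegressorLaw μ lam) {j : ℕ} (hj : 1 ≤ j) :
    ∫ x, ⟪wave j 0, x⟫ ^ 2 ∂μ = lam (2 * j) := by
  have h := covarianceOperator_inner hμ.memLp_two (trig (2 * j)) (trig (2 * j))
  rw [hμ.eigen _ (by omega), inner_smul_left, trig_two_mul hj, inner_wave _ hj, if_pos rfl,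
    sub_self, Real.cos_zero] at h
  simp_rw [sq]
  rw [← h]
  simp

/-- The sign `±1` of a Boolean. -/
def boolSign (x : Bool) : ℝ := if x then 1 else -1

theorem boolSign_not (x : Bool) : boolSign (!x) = -boolSign x := by
  cases x <;> simp [boolSign]

theorem boolSign_sq (x : Bool) : boolSign x ^ 2 = 1 := by
  cases x <;> simp [boolSign]

/-- The vertex `b ∑ ±ψ₂ⱼ` of a cube of slope functions. -/
noncomputable def cubeSlope (b : ℝ) (F : Finset ℕ) (θ : F → Bool) : L2 :=
  ∑ i : F, (b * boolSign (θ i)) • wave i 0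

/-- The `s`-th weak derivative of `cubeSlope`. -/
noncomputable def cubeDeriv (s : ℕ) (b : ℝ) (F : Finset ℕ) (θ : F → Bool) : L2 :=
  ∑ i : F, (boolSign (θ i) * (b * (2 * Real.pi * i) ^ s)) • wave i (s * (Real.pi / 2))

theorem isWeakDeriv_cubeSlope (s : ℕ) (b : ℝ) (F : Finset ℕ) (θ : F → Bool) :
    IsWeakDeriv s (cubeSlope b F θ) (cubeDeriv s b F θ) := by
  refine IsWeakDeriv.sum _ fun i _ => ?_
  have h := (isWeakDeriv_wave i s 0).smul (b * boolSign (θ i))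
  rw [zero_add, smul_smul] at h
  convert h using 2
  ring

theorem cubeSlope_mem_sobolevEllipsoid {p ρ b : ℝ} {F : Finset ℕ} (hF : ∀ j ∈ F, 1 ≤ j)
    (hb : ∑ j ∈ F, (j : ℝ) ^ (2 * p) * b ^ 2 ≤ ρ) (θ : F → Bool) :
    cubeSlope b F θ ∈ sobolevEllipsoid p ρ := by
  have hin : ∀ l, 1 ≤ l → ⟪cubeSlope b F θ, trig l⟫ =
      ∑ i : F, if l = 2 * i then b * boolSign (θ i) else 0 := by
    intro l hl
    rw [cubeSlope, sum_inner]
    refine Finset.sum_congr rfl fun i _ => ?_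
    rw [inner_smul_left, inner_wave_trig (hF i i.2) hl]
    simp
  have hsq : ∀ i : F, ⟪cubeSlope b F θ, trig (2 * i)⟫ ^ 2 = b ^ 2 := by
    intro i
    rw [hin _ (by have := hF i i.2; omega), Finset.sum_eq_single i]
    · rw [if_pos rfl, mul_pow, boolSign_sq, mul_one]
    · intro k _ hk
      exact if_neg fun h => hk (Subtype.ext (by omega))
    · simp
  -- The series is indexed from 0 with `ψ_{l+1}` at `l`, so `ψ_{2i}` sits at `l = 2i - 1`.
  rw [sobolevEllipsoid, mem_ofPred_eq, weightedNormSq,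
    tsum_eq_sum (s := F.image fun i => 2 * i - 1)]
  · rw [Finset.sum_image fun i hi k hk h => by
        have := hF i hi; have := hF k hk; omega,
      ← ENNReal.ofReal_sum_of_nonneg]
    · refine ENNReal.ofReal_le_ofReal (le_of_eq_of_le (Finset.sum_congr rfl fun i hi => ?_) hb)
      have h1 := hF i hi
      have h2 : 2 * i - 1 + 1 = 2 * i := by omega
      rw [h2, hsq ⟨i, hi⟩, sobolevWeight, if_neg (by omega), Nat.mul_div_cancel_left _ two_pos]
    · intro i _
      refine mul_nonneg ?_ (sq_nonneg _)
      rw [sobolevWeight]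
      split_ifs <;> positivity
  · intro l hl
    rw [hin _ (by omega), Finset.sum_eq_zero]
    · simp
    · intro i _
      refine if_neg fun h => hl (Finset.mem_image.2 ⟨i, i.2, ?_⟩)
      omega

/-- The vertex of the cube opposite to `θ` in direction `j`. -/
def flipAt {F : Finset ℕ} (j : F) (θ : F → Bool) : F → Bool := Function.update θ j (!θ j)

theorem flipAt_involutive {F : Finset ℕ} (j : F) : Function.Involutive (flipAt j) := by
  intro θ
  simp [flipAt]

/-- Subtracting the same vector twice exhibits the midpoint of the two vertices, the center `β` of
the two-point bound. -/
theorem cubeSlope_flipAt (b : ℝ) {F : Finset ℕ} (j : F) (θ : F → Bool) :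
    cubeSlope b F (flipAt j θ) =
      cubeSlope b F θ - (b * boolSign (θ j)) • wave j 0 - (b * boolSign (θ j)) • wave j 0 := by
  rw [cubeSlope, cubeSlope, ← Finset.add_sum_erase _ _ (Finset.mem_univ j),
    ← Finset.add_sum_erase (a := j) _ (fun i : F => (b * boolSign (θ i)) • wave i 0)
      (Finset.mem_univ j)]
  have h : ∑ i ∈ Finset.univ.erase j, (b * boolSign (flipAt j θ i)) • wave i 0 =
      ∑ i ∈ Finset.univ.erase j, (b * boolSign (θ i)) • wave i 0 :=
    Finset.sum_congr rfl fun i hi => by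
      rw [flipAt, Function.update_of_ne (Finset.ne_of_mem_erase hi)]
  rw [h, flipAt, Function.update_self, boolSign_not, mul_neg, neg_smul]
  abel

/-- Bessel's inequality for the phase-shifted waves, which splits the loss into one sign problem per
frequency. -/
theorem sum_sq_le_enorm_sub_cubeDeriv_sq (s : ℕ) (b : ℝ) {F : Finset ℕ} (hF : ∀ j ∈ F, 1 ≤ j)
    (θ : F → Bool) (v : L2) :
    ∑ j : F, ENNReal.ofReal ((⟪wave j (s * (Real.pi / 2)), v⟫ -
      boolSign (θ j) * (b * (2 * Real.pi * j) ^ s)) ^ 2) ≤ ‖v - cubeDeriv s b F θ‖ₑ ^ 2 := by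
  have ho := orthonormal_wave (s * (Real.pi / 2)) F hF
  have h := ho.sum_inner_products_le (v - cubeDeriv s b F θ) (s := Finset.univ)
  have hin : ∀ j : F, ⟪wave j (s * (Real.pi / 2)), v - cubeDeriv s b F θ⟫ =
      ⟪wave j (s * (Real.pi / 2)), v⟫ - boolSign (θ j) * (b * (2 * Real.pi * j) ^ s) := by
    intro j
    rw [inner_sub_right, cubeDeriv]
    congr 1
    exact ho.inner_right_fintype
      (fun i : F => boolSign (θ i) * (b * (2 * Real.pi * i) ^ s)) j
  simp_rw [hin, Real.norm_eq_abs, sq_abs] at h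
  rw [← ENNReal.ofReal_sum_of_nonneg fun _ _ => sq_nonneg _, ← ofReal_norm,
    ← ENNReal.ofReal_pow (norm_nonneg _)]
  exact ENNReal.ofReal_le_ofReal h

/-- Assouad's bound over a cube of trigonometric slope functions. -/
theorem cube_lower_bound {p σ ρ b : ℝ} (s : ℕ) (hσ : 0 < σ) {n : ℕ} {μ : Measure L2}
    {lam : ℕ → ℝ} (hμ : IsRegressorLaw μ lam) {F : Finset ℕ} (hF : ∀ j ∈ F, 1 ≤ j)
    (hb : ∑ j ∈ F, (j : ℝ) ^ (2 * p) * b ^ 2 ≤ ρ)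
    (hn : ∀ j ∈ F, n * (b ^ 2 * lam (2 * j)) ≤ σ ^ 2)
    {T : (Fin n → ℝ × L2) → L2} (hT : Measurable T) :
    ENNReal.ofReal (Real.exp (-2) * ∑ j ∈ F, (b * (2 * Real.pi * j) ^ s) ^ 2) ≤
      maxRisk μ σ p ρ s n T := by
  have := hμ.isProbabilityMeasure
  set c : ℕ → ℝ := fun j => b * (2 * Real.pi * j) ^ s
  set t : ℕ → (Fin n → ℝ × L2) → ℝ := fun j z => ⟪wave j (s * (Real.pi / 2)), T z⟫
  have ht : ∀ j, Measurable (t j) := fun j => (measurable_inner_left _).comp hT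
  set R : F → (F → Bool) → ℝ≥0∞ := fun j θ =>
    ∫⁻ z, ENNReal.ofReal ((t j z - boolSign (θ j) * c j) ^ 2)
      ∂sampleLaw μ σ (cubeSlope b F θ) n with hR
  have hrisk : ∀ θ, ∑ j, R j θ ≤ maxRisk μ σ p ρ s n T := by
    intro θ
    calc ∑ j, R j θ = ∫⁻ z, ∑ j : F, ENNReal.ofReal ((t j z - boolSign (θ j) * c j) ^ 2)
          ∂sampleLaw μ σ (cubeSlope b F θ) n :=
          (lintegral_finsetSum _ fun j _ => by have := ht j; fun_prop).symm
      _ ≤ ∫⁻ z, ‖T z - cubeDeriv s b F θ‖ₑ ^ 2 ∂sampleLaw μ σ (cubeSlope b F θ) n :=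
          lintegral_mono fun z => sum_sq_le_enorm_sub_cubeDeriv_sq s b hF θ (T z)
      _ ≤ _ := by
          refine le_iSup₂_of_le _ (cubeSlope_mem_sobolevEllipsoid hF hb θ) ?_
          exact le_iSup₂ (f := fun (g : L2) (_ : IsWeakDeriv s (cubeSlope b F θ) g) =>
            ∫⁻ z, ‖T z - g‖ₑ ^ 2 ∂sampleLaw μ σ (cubeSlope b F θ) n) _
            (isWeakDeriv_cubeSlope s b F θ)
  have hpair : ∀ (j : F) θ,
      ENNReal.ofReal (2 * c j ^ 2 * Real.exp (-2)) ≤ R j θ + R j (flipAt j θ) := by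
    intro j θ
    set δ : L2 := (b * boolSign (θ j)) • wave j 0 with hδ
    have hint : n * ∫ x, ⟪δ, x⟫ ^ 2 ∂μ ≤ σ ^ 2 := by
      simp_rw [hδ, inner_smul_left, mul_pow]
      rw [integral_const_mul, hμ.integral_inner_wave_sq (hF j j.2)]
      simpa [mul_pow, boolSign_sq] using hn j j.2
    have h := two_point_lower_bound μ hσ.ne' (cubeSlope b F θ - δ) δ n
      (memLp_inner hμ.memLp_two δ) hint (boolSign (θ j) * c j) (ht j)
    rw [mul_pow, boolSign_sq, one_mul, sub_add_cancel, ← cubeSlope_flipAt] at h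
    simpa [hR, flipAt, boolSign_not] using h
  have hsum : ∀ j : F, (Fintype.card (F → Bool) : ℝ≥0∞) *
      ENNReal.ofReal (Real.exp (-2) * c j ^ 2) ≤ ∑ θ, R j θ := by
    intro j
    -- Flipping permutes the vertices, so summing the pair bounds counts every risk twice.
    have hflip : ∑ θ, R j (flipAt j θ) = ∑ θ, R j θ :=
      (flipAt_involutive j).bijective.sum_comp (R j)
    have h2 : 2 * ((Fintype.card (F → Bool) : ℝ≥0∞) *
        ENNReal.ofReal (Real.exp (-2) * c j ^ 2)) ≤ 2 * ∑ θ, R j θ := by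
      calc _ = ∑ _θ : F → Bool, ENNReal.ofReal (2 * c j ^ 2 * Real.exp (-2)) := by
            rw [Finset.sum_const, nsmul_eq_mul, Finset.card_univ, mul_left_comm]
            congr 1
            rw [← ENNReal.ofReal_ofNat 2, ← ENNReal.ofReal_mul zero_le_two]
            congr 1
            ring
        _ ≤ ∑ θ, (R j θ + R j (flipAt j θ)) := Finset.sum_le_sum fun θ _ => hpair j θ
        _ = _ := by rw [Finset.sum_add_distrib, hflip, two_mul]
    exact (ENNReal.mul_le_mul_iff_right two_ne_zero ENNReal.ofNat_ne_top).1 h2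
  have hfin : (Fintype.card (F → Bool) : ℝ≥0∞) *
      ENNReal.ofReal (Real.exp (-2) * ∑ j ∈ F, c j ^ 2) ≤
        (Fintype.card (F → Bool) : ℝ≥0∞) * maxRisk μ σ p ρ s n T := by
    calc _ = ∑ j : F, (Fintype.card (F → Bool) : ℝ≥0∞) *
          ENNReal.ofReal (Real.exp (-2) * c j ^ 2) := by
          rw [← Finset.sum_coe_sort F fun j => c j ^ 2, Finset.mul_sum,
            ENNReal.ofReal_sum_of_nonneg fun j _ => by positivity, Finset.mul_sum]
      _ ≤ ∑ j, ∑ θ, R j θ := Finset.sum_le_sum fun j _ => hsum j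
      _ = ∑ θ, ∑ j, R j θ := Finset.sum_comm
      _ ≤ ∑ _θ : F → Bool, maxRisk μ σ p ρ s n T := Finset.sum_le_sum fun θ _ => hrisk θ
      _ = _ := by rw [Finset.sum_const, nsmul_eq_mul, Finset.card_univ]
  exact (ENNReal.mul_le_mul_iff_right (by exact_mod_cast Fintype.card_ne_zero)
    (ENNReal.natCast_ne_top _)).1 hfin

/-! ### Choice of the cube in the two cases -/

theorem sq_mul_rpow_le {b K j : ℝ} (hK : 0 < K) (hj : K ≤ j) (s : ℕ) :
    b ^ 2 * K ^ (2 * (s : ℝ)) ≤ (b * (2 * Real.pi * j) ^ s) ^ 2 := by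
  have h1 : K ≤ 2 * Real.pi * j := by nlinarith [Real.pi_gt_three]
  have h2 : K ^ (2 * (s : ℝ)) = (K ^ s) ^ 2 := by
    rw [← Real.rpow_natCast, ← Real.rpow_natCast, ← Real.rpow_mul hK.le]
    congr 1
    push_cast
    ring
  rw [h2, mul_pow]
  gcongr

theorem natCeil_le_two_mul {x : ℝ} (hx : 1 ≤ x) : (⌈x⌉₊ : ℝ) ≤ 2 * x := by
  linarith [Nat.ceil_lt_add_one (zero_le_one.trans hx)]

theorem maxRisk_polynomial_lower_bound {p σ ρ d a : ℝ} {s : ℕ} (hsp : (s : ℝ) ≤ p) (hσ : 0 < σ)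
    (hρ : 0 < ρ) (hd : 1 ≤ d) (ha : 1 / 2 < a) {n : ℕ} (hn : 1 ≤ n) {μ : Measure L2}
    {lam : ℕ → ℝ} (hμ : IsRegressorLaw μ lam) (hlam : lam ∈ linkClass (polyWeight a) d)
    {T : (Fin n → ℝ × L2) → L2} (hT : Measurable T) :
    ENNReal.ofReal (Real.exp (-2) * min ρ (σ ^ 2 / d) / 2 ^ (2 * p) * 2 ^ (-(2 * p - 2 * s)) *
      (n : ℝ) ^ (-(2 * p - 2 * s) / (2 * p + 2 * a + 1))) ≤ maxRisk μ σ p ρ s n T := by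
  have hs : (0 : ℝ) ≤ s := Nat.cast_nonneg s
  have hd0 : 0 < d := by linarith
  have hn1 : (1 : ℝ) ≤ n := by exact_mod_cast hn
  set r := 2 * p + 2 * a + 1 with hr
  have hr0 : 0 < r := by linarith
  set τ := min ρ (σ ^ 2 / d)
  have hτ : 0 < τ := lt_min hρ (by positivity)
  have hdτ : d * τ ≤ σ ^ 2 := by
    rw [← le_div_iff₀' hd0]
    exact min_le_right _ _
  have hx1 : 1 ≤ (n : ℝ) ^ (1 / r) := Real.one_le_rpow hn1 (by positivity)
  -- This balances `n b² λ_{2j}`, of order `n k^{-2p-1} k^{-2a}`, against a constant.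
  set k := ⌈(n : ℝ) ^ (1 / r)⌉₊ with hk
  have hkx : (n : ℝ) ^ (1 / r) ≤ k := Nat.le_ceil _
  have hk1 : (1 : ℝ) ≤ k := hx1.trans hkx
  have hk0 : (0 : ℝ) < k := by linarith
  have hkN : 1 ≤ k := by exact_mod_cast hk1
  have hkr : (n : ℝ) ≤ (k : ℝ) ^ r := by
    calc (n : ℝ) = ((n : ℝ) ^ (1 / r)) ^ r := by
          rw [← Real.rpow_mul (by positivity), one_div_mul_cancel hr0.ne', Real.rpow_one]
      _ ≤ _ := Real.rpow_le_rpow (by positivity) hkx hr0.le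
  have hb2 : 0 ≤ τ / (k * (2 * k : ℝ) ^ (2 * p)) := by positivity
  -- With `k` frequencies below `2k`, the ellipsoid norm is at most `τ ≤ ρ`; the bound `dτ ≤ σ²`
  -- serves the noise condition.
  set b := √(τ / (k * (2 * k : ℝ) ^ (2 * p)))
  have hb : b ^ 2 = τ / (k * (2 * k : ℝ) ^ (2 * p)) := Real.sq_sqrt hb2
  have hmem : ∀ j ∈ Finset.Ico k (2 * k), (k : ℝ) ≤ j ∧ (j : ℝ) ≤ 2 * k := by
    intro j hj
    rw [Finset.mem_Ico] at hj
    exact ⟨by exact_mod_cast hj.1, by exact_mod_cast hj.2.le⟩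
  have hcard : (Finset.Ico k (2 * k)).card = k := by rw [Nat.card_Ico]; omega
  have hF : ∀ j ∈ Finset.Ico k (2 * k), 1 ≤ j := fun j hj =>
    hkN.trans (Finset.mem_Ico.1 hj).1
  have hell : ∑ j ∈ Finset.Ico k (2 * k), (j : ℝ) ^ (2 * p) * b ^ 2 ≤ ρ := by
    calc _ ≤ ∑ _j ∈ Finset.Ico k (2 * k), (2 * k : ℝ) ^ (2 * p) * b ^ 2 := by
          refine Finset.sum_le_sum fun j hj => ?_
          have := hmem j hj
          gcongr
          · linarith
          · exact this.2
      _ = τ := by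
          rw [Finset.sum_const, hcard, nsmul_eq_mul, hb]
          field_simp
      _ ≤ ρ := min_le_left _ _
  have hsig : ∀ j ∈ Finset.Ico k (2 * k), n * (b ^ 2 * lam (2 * j)) ≤ σ ^ 2 := by
    intro j hj
    have hj1 := hF j hj
    have hjk := (hmem j hj).1
    have hj0 : (0 : ℝ) < j := by linarith
    have hw : polyWeight a (2 * j) = (2 * j : ℝ) ^ (-(2 * a)) := by
      rw [polyWeight, if_neg (by omega)]
      push_cast
      rfl
    have hl : lam (2 * j) ≤ d * (k : ℝ) ^ (-(2 * a)) := by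
      have h := (hlam (2 * j) (by omega)).2
      rw [hw, div_le_iff₀ (by positivity)] at h
      refine h.trans (mul_le_mul_of_nonneg_left ?_ hd0.le)
      exact Real.rpow_le_rpow_of_nonpos hk0 (by linarith) (by linarith)
    have hb' : b ^ 2 ≤ τ / (k * (k : ℝ) ^ (2 * p)) := by
      rw [hb]
      gcongr
      · linarith
      · linarith
    have hpow : (k : ℝ) * (k : ℝ) ^ (2 * p) * (k : ℝ) ^ (2 * a) = (k : ℝ) ^ r := by
      rw [hr, Real.rpow_add hk0, Real.rpow_add hk0, Real.rpow_one]
      ring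
    calc n * (b ^ 2 * lam (2 * j))
        ≤ n * (τ / (k * (k : ℝ) ^ (2 * p)) * (d * (k : ℝ) ^ (-(2 * a)))) := by
          refine mul_le_mul_of_nonneg_left ?_ (by positivity)
          exact (mul_le_mul_of_nonneg_left hl (sq_nonneg b)).trans
            (mul_le_mul_of_nonneg_right hb' (by positivity))
      _ = d * τ * (n / (k : ℝ) ^ r) := by
          rw [← hpow, Real.rpow_neg hk0.le]
          field_simp
      _ ≤ d * τ * 1 := by
          gcongr
          exact div_le_one_of_le₀ hkr (by positivity)
      _ ≤ σ ^ 2 := by rw [mul_one]; exact hdτ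
  refine le_trans (ENNReal.ofReal_le_ofReal ?_) (cube_lower_bound s hσ hμ hF hell hsig hT)
  have hrate : (k : ℝ) ^ (-(2 * p - 2 * s)) ≥
      2 ^ (-(2 * p - 2 * s)) * (n : ℝ) ^ (-(2 * p - 2 * s) / r) := by
    calc (k : ℝ) ^ (-(2 * p - 2 * s)) ≥ (2 * (n : ℝ) ^ (1 / r)) ^ (-(2 * p - 2 * s)) :=
          Real.rpow_le_rpow_of_nonpos hk0 (natCeil_le_two_mul hx1) (by linarith)
      _ = _ := by
          rw [Real.mul_rpow zero_le_two (by positivity), ← Real.rpow_mul (by positivity)]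
          congr 2
          ring
  calc _ = Real.exp (-2) * (τ / 2 ^ (2 * p) *
        (2 ^ (-(2 * p - 2 * s)) * (n : ℝ) ^ (-(2 * p - 2 * s) / r))) := by ring
    _ ≤ Real.exp (-2) * (τ / 2 ^ (2 * p) * (k : ℝ) ^ (-(2 * p - 2 * s))) := by gcongr
    _ = Real.exp (-2) * ∑ _j ∈ Finset.Ico k (2 * k), b ^ 2 * (k : ℝ) ^ (2 * (s : ℝ)) := by
        rw [Finset.sum_const, hcard, nsmul_eq_mul, hb, neg_sub, Real.rpow_sub hk0,
          Real.mul_rpow zero_le_two hk0.le]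
        field_simp
    _ ≤ _ := by
        refine mul_le_mul_of_nonneg_left (Finset.sum_le_sum fun j hj => ?_) (Real.exp_pos _).le
        exact sq_mul_rpow_le hk0 (hmem j hj).1 s

theorem maxRisk_exponential_lower_bound {p σ ρ d a : ℝ} {s : ℕ} (hsp : (s : ℝ) ≤ p) (hσ : 0 < σ)
    (hρ : 0 < ρ) (hd : 1 ≤ d) (ha : 0 < a) {n : ℕ} (hn : 3 ≤ n) {μ : Measure L2}
    {lam : ℕ → ℝ} (hμ : IsRegressorLaw μ lam) (hlam : lam ∈ linkClass (expWeight a) d)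
    {T : (Fin n → ℝ × L2) → L2} (hT : Measurable T) :
    ENNReal.ofReal (Real.exp (-2) * min ρ (σ ^ 2 / d) * 2 ^ (-(2 * p - 2 * s)) *
      Real.log n ^ (-(p - s) / a)) ≤ maxRisk μ σ p ρ s n T := by
  have hs : (0 : ℝ) ≤ s := Nat.cast_nonneg s
  have hd0 : 0 < d := by linarith
  have hn3 : (3 : ℝ) ≤ n := by exact_mod_cast hn
  have hn0 : (0 : ℝ) < n := by linarith
  -- The bound `n ≥ 3 > e` gives this; it lets the ceiling below cost at most a factor 2.
  have hlog : 1 ≤ Real.log n := by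
    rw [Real.le_log_iff_exp_le hn0]
    linarith [Real.exp_one_lt_d9]
  have hlog0 : 0 ≤ Real.log n := by linarith
  set τ := min ρ (σ ^ 2 / d)
  have hτ : 0 < τ := lt_min hρ (by positivity)
  have hdτ : d * τ ≤ σ ^ 2 := by
    rw [← le_div_iff₀' hd0]
    exact min_le_right _ _
  have hx1 : 1 ≤ Real.log n ^ (1 / (2 * a)) := Real.one_le_rpow hlog (by positivity)
  set k := ⌈Real.log n ^ (1 / (2 * a))⌉₊ with hk
  have hkx : Real.log n ^ (1 / (2 * a)) ≤ k := Nat.le_ceil _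
  have hk1 : (1 : ℝ) ≤ k := hx1.trans hkx
  have hk0 : (0 : ℝ) < k := by linarith
  have hkN : 1 ≤ k := by exact_mod_cast hk1
  -- Hence `exp(-(2k)^{2a}) ≤ 1/n`, so `λ_{2k} ≤ d/n`, and `b² ≤ τ` already suffices for the noise
  -- condition.
  have hkr : Real.log n ≤ (2 * k : ℝ) ^ (2 * a) := by
    calc Real.log n = (Real.log n ^ (1 / (2 * a))) ^ (2 * a) := by
          rw [← Real.rpow_mul hlog0, one_div_mul_cancel (by positivity), Real.rpow_one]
      _ ≤ _ := Real.rpow_le_rpow (by positivity) (by linarith) (by positivity)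
  have hb2 : 0 ≤ τ / (k : ℝ) ^ (2 * p) := by positivity
  set b := √(τ / (k : ℝ) ^ (2 * p))
  have hb : b ^ 2 = τ / (k : ℝ) ^ (2 * p) := Real.sq_sqrt hb2
  have hF : ∀ j ∈ ({k} : Finset ℕ), 1 ≤ j := by simpa using hkN
  have hell : ∑ j ∈ ({k} : Finset ℕ), (j : ℝ) ^ (2 * p) * b ^ 2 ≤ ρ := by
    rw [Finset.sum_singleton, hb, mul_div_cancel₀ _ (by positivity)]
    exact min_le_left _ _
  have hsig : ∀ j ∈ ({k} : Finset ℕ), n * (b ^ 2 * lam (2 * j)) ≤ σ ^ 2 := by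
    intro j hj
    rw [Finset.mem_singleton] at hj
    subst j
    have hw : expWeight a (2 * k) = Real.exp (-((2 * k : ℝ) ^ (2 * a))) := by
      rw [expWeight, if_neg (by omega)]
      push_cast
      rfl
    have hl : lam (2 * k) ≤ d * (n : ℝ)⁻¹ := by
      have h := (hlam (2 * k) (by omega)).2
      rw [hw, div_le_iff₀ (by positivity)] at h
      refine h.trans (mul_le_mul_of_nonneg_left ?_ hd0.le)
      rw [← Real.exp_log hn0, ← Real.exp_neg]
      exact Real.exp_le_exp.2 (neg_le_neg hkr)
    have hb' : b ^ 2 ≤ τ := by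
      rw [hb]
      exact div_le_self hτ.le (Real.one_le_rpow hk1 (by linarith))
    calc n * (b ^ 2 * lam (2 * k)) ≤ n * (τ * (d * (n : ℝ)⁻¹)) := by
          refine mul_le_mul_of_nonneg_left ?_ hn0.le
          exact (mul_le_mul_of_nonneg_left hl (sq_nonneg b)).trans
            (mul_le_mul_of_nonneg_right hb' (by positivity))
      _ = d * τ := by field_simp
      _ ≤ σ ^ 2 := hdτ
  refine le_trans (ENNReal.ofReal_le_ofReal ?_) (cube_lower_bound s hσ hμ hF hell hsig hT)
  have hrate : (k : ℝ) ^ (-(2 * p - 2 * s)) ≥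
      2 ^ (-(2 * p - 2 * s)) * Real.log n ^ (-(p - s) / a) := by
    calc (k : ℝ) ^ (-(2 * p - 2 * s)) ≥
          (2 * Real.log n ^ (1 / (2 * a))) ^ (-(2 * p - 2 * s)) :=
          Real.rpow_le_rpow_of_nonpos hk0 (natCeil_le_two_mul hx1) (by linarith)
      _ = _ := by
          rw [Real.mul_rpow zero_le_two (by positivity), ← Real.rpow_mul hlog0]
          congr 2
          field_simp
  calc _ = Real.exp (-2) * (τ *
        (2 ^ (-(2 * p - 2 * s)) * Real.log n ^ (-(p - s) / a))) := by ring
    _ ≤ Real.exp (-2) * (τ * (k : ℝ) ^ (-(2 * p - 2 * s))) := by gcongr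
    _ = Real.exp (-2) * (b ^ 2 * (k : ℝ) ^ (2 * (s : ℝ))) := by
        rw [hb, neg_sub, Real.rpow_sub hk0]
        field_simp
    _ ≤ _ := by
        rw [Finset.sum_singleton]
        exact mul_le_mul_of_nonneg_left (sq_mul_rpow_le hk0 le_rfl s) (Real.exp_pos _).le

end FunctionalLinearModel

open FunctionalLinearModel in
theorem proposition4p3 (p σ ρ d : ℝ) (s : ℕ) (hsp : (s : ℝ) ≤ p)
    (hσ : 0 < σ) (hρ : 0 < ρ) (hd : 1 ≤ d) :
    (∀ a : ℝ, 1 / 2 < a → ∃ C : ℝ, 0 < C ∧ ∃ N : ℕ, ∀ n : ℕ, N ≤ n →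
      ∀ (μ : Measure L2) (lam : ℕ → ℝ), IsRegressorLaw μ lam →
        lam ∈ linkClass (polyWeight a) d →
        ∀ T : (Fin n → ℝ × L2) → L2, Measurable T →
          ENNReal.ofReal (C * (n : ℝ) ^ (-(2 * p - 2 * s) / (2 * p + 2 * a + 1)))
            ≤ maxRisk μ σ p ρ s n T) ∧
    (∀ a : ℝ, 0 < a → ∃ C : ℝ, 0 < C ∧ ∃ N : ℕ, ∀ n : ℕ, N ≤ n →
      ∀ (μ : Measure L2) (lam : ℕ → ℝ), IsRegressorLaw μ lam →
        lam ∈ linkClass (expWeight a) d →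
        ∀ T : (Fin n → ℝ × L2) → L2, Measurable T →
          ENNReal.ofReal (C * Real.log n ^ (-(p - s) / a))
            ≤ maxRisk μ σ p ρ s n T) := by
  have hd0 : 0 < d := by linarith
  have hτ : 0 < min ρ (σ ^ 2 / d) := lt_min hρ (by positivity)
  refine ⟨fun a ha => ⟨_, ?_, 1, fun n hn μ lam hμ hlam T hT =>
    maxRisk_polynomial_lower_bound hsp hσ hρ hd ha hn hμ hlam hT⟩,
    fun a ha => ⟨_, ?_, 3, fun n hn μ lam hμ hlam T hT =>
    maxRisk_exponential_lower_bound hsp hσ hρ hd ha hn hμ hlam hT⟩⟩ <;> positivity
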